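/- **Setting.** Let $D\subset\mathbb R^d$ be a bounded open set (for instance a bounded Lipschitz domain), let $f\in L^2(D)$, and let $k=k_0+k_1$ on $D$, where $k,k_0$ are measurable and $0<a_0\le k\le a_1$, $0<b_0\le k_0\le b_1$ on $D$. Write $H^1_0(U)$ for the closure of $C_c^\infty(U)$ in $H^1(U)$, $(\cdot,\cdot)_U$ for the $L^2(U)$ inner product, and $|||v|||=(k\nabla v,\nabla v)_D^{1/2}$. Let $u\in H^1_0(D)$ be the weak solution of $-\nabla\cdot(k\nabla u)=f$ in $D$, $u=0$ on $\partial D$, that is, $(k\nabla u,\nabla w)_D=(f,w)_D$ for all $w\in H_0^1(D)$. Let $\mathfrak T_h$ be a finite partition of $D$ into cells: the cells are pairwise disjoint open subsets $K\subset D$ that cover $D$ up to a null set. Each cell $K$ has finitely many local vertices $i$, each of which corresponds to a global node $\nu(K,i)$; some of the nodes are designated as interior nodes. For each $K$ and $i$ let $l_{K,i}\in H^1(K)$ be given boundary data (extended to $K$). * The standard basis function $\phi_{K,i}\in H^1(K)$ solves weakly $-\nabla\cdot(k\nabla\phi_{K,i})=0$ in $K$, $\phi_{K,i}=l_{K,i}$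 on $\partial K$ (that is, $\phi_{K,i}-l_{K,i}\in H^1_0(K)$). * $\Pi l_{K,i}\in H^1_0(K)$ satisfies $(k_0\nabla\Pi l_{K,i},\nabla w)_K=(k_0\nabla l_{K,i},\nabla w)_K$ for all $w\in H^1_0(K)$. * The functions $\tilde\xi_j=(\tilde\xi_j)_{K,i}\in H^1_0(K)$, $j\ge 0$, solve weakly in $K$ $$-\nabla\cdot(k_0\nabla\tilde\xi_0)=-\nabla\cdot\big(k_1\nabla(\Pi l_{K,i}-l_{K,i})\big),\qquad -\nabla\cdot(k_0\nabla\tilde\xi_{j+1})=\nabla\cdot(k_1\nabla\tilde\xi_j).$$ * For an integer $J\ge 0$, the new basis function is $(\phi_J)_{K,i}=l_{K,i}-\Pi l_{K,i}+\sum_{j=0}^J(\tilde\xi_j)_{K,i}$. A family of local functions $(g_{K,i})$ is glued at a node $q$ into the function on $D$ which on every cell $K$ equals $\sum_{i:\,\nu(K,i)=q}g_{K,i}$. Assume that the boundary data are conforming: for every interior node $q$ the function glued from $(l_{K,i})$ at $q$ belongs to $H^1_0(D)$. Let $V_h$ (respectively $V_{J,h}$) be the span of the functions glued from $(\phi_{K,i})$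 (respectively from $((\phi_J)_{K,i})$) at the interior nodes. The standard MsFEM solution $u_h\in V_h$ satisfies $(k\nabla u_h,\nabla w)_D=(f,w)_D$ for all $w\in V_h$; the new MsFEM solution $u_{J,h}\in V_{J,h}$ satisfies $(k\nabla u_{J,h},\nabla w)_D=(f,w)_D$ for all $w\in V_{J,h}$. **Theorem.** Put $$\eta=\max_{K\in\mathfrak T_h}\Big\|\frac{k_1}{k_0}\Big\|_{L^\infty(K)},\qquad \tilde c=\sqrt2\,\max_{K\in\mathfrak T_h}\Big\|\sqrt{\frac{k_0}{k}}\Big\|_{L^\infty(K)},$$ and assume $\eta<1$. Then, for every $J\ge 0$, (1) $\displaystyle |||u_h-u_{J,h}|||\le \tilde c^{1/2}\Big(\eta^{J+1}+\frac{\eta^{J+1}}{1-\eta^{J+1}}\Big)^{1/2}|||u|||$; (2) $\displaystyle |||u-u_{J,h}|||\le \sqrt2\,\tilde c\Big(\eta^{J+1}+\frac{\eta^{J+1}}{1-\eta^{J+1}}\Big)|||u|||+2\,|||u-u_h|||$. -/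

import Mathlib

open MeasureTheory Filter Topology
open scoped ContDiff

namespace MsFEM

noncomputable section

/-- The Euclidean space of dimension `d`. -/
abbrev Rd (d : ℕ) : Type := EuclideanSpace ℝ (Fin d)

/-- `ψ` is a test function on `U`: an element of `C_c^∞(U)`, extended by zero. -/
def IsTest {d : ℕ} (U : Set (Rd d)) (ψ : Rd d → ℝ) : Prop :=
  ContDiff ℝ ∞ ψ ∧ HasCompactSupport ψ ∧ tsupport ψ ⊆ U

/-- `g` is a square-integrable weak gradient of `v` on the open set `U`. -/
def HasWeakGrad {d : ℕ} (U : Set (Rd d)) (v : Rd d → ℝ) (g : Rd d → Rd d) : Prop :=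
  MemLp g 2 (volume.restrict U) ∧
    ∀ ψ : Rd d → ℝ, IsTest U ψ → ∀ i : Fin d,
      ∫ x in U, v x * gradient ψ x i = -∫ x in U, g x i * ψ x

/-- The Sobolev space `H¹(U)`. A function on `U` is represented by a function on the whole space;
its values outside `U` play no role. -/
def MemH1 {d : ℕ} (U : Set (Rd d)) (v : Rd d → ℝ) : Prop :=
  MemLp v 2 (volume.restrict U) ∧ ∃ g : Rd d → Rd d, HasWeakGrad U v g

open Classical in
/-- The weak gradient on `U` of a function in `H¹(U)` (unique up to null subsets of `U`). -/
def weakGrad {d : ℕ} (U : Set (Rd d)) (v : Rd d → ℝ) : Rd d → Rd d :=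
  if h : ∃ g : Rd d → Rd d, HasWeakGrad U v g then h.choose else 0

/-- The space `H¹₀(U)`: the closure of `C_c^∞(U)` in `H¹(U)`. -/
def MemH10 {d : ℕ} (U : Set (Rd d)) (v : Rd d → ℝ) : Prop :=
  MemH1 U v ∧ ∃ ψ : ℕ → Rd d → ℝ, (∀ n, IsTest U (ψ n)) ∧
    Tendsto (fun n => eLpNorm (fun x => v x - ψ n x) 2 (volume.restrict U)) atTop (𝓝 0) ∧
    Tendsto (fun n => eLpNorm (fun x => weakGrad U v x - gradient (ψ n) x) 2
      (volume.restrict U)) atTop (𝓝 0)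

/-- The bilinear form `(c ∇v, ∇w)_U`. -/
def form {d : ℕ} (c : Rd d → ℝ) (U : Set (Rd d)) (v w : Rd d → ℝ) : ℝ :=
  ∫ x in U, c x * inner ℝ (weakGrad U v x) (weakGrad U w x)

/-- The energy norm `|||v|||_U = ((k ∇v, ∇v)_U)^{1/2}`. -/
def energyNorm {d : ℕ} (k : Rd d → ℝ) (U : Set (Rd d)) (v : Rd d → ℝ) : ℝ :=
  Real.sqrt (form k U v v)

/-- The norm of `L^∞(U)` (the essential supremum of `|c|` on `U`). -/
def linftyNorm {d : ℕ} (U : Set (Rd d)) (c : Rd d → ℝ) : ℝ :=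
  (eLpNorm c ⊤ (volume.restrict U)).toReal

/-- The function `u ∈ H¹₀(D)` is the weak solution of `-∇·(k∇u) = f` in `D`, `u = 0` on `∂D`. -/
def IsWeakSolution {d : ℕ} (k : Rd d → ℝ) (D : Set (Rd d)) (f u : Rd d → ℝ) : Prop :=
  MemH10 D u ∧ ∀ w : Rd d → ℝ, MemH10 D w → form k D u w = ∫ x in D, f x * w x

/-- The function `v` is the Galerkin solution in the finite element space `V`. -/
def IsGalerkinSolution {d : ℕ} (k : Rd d → ℝ) (D : Set (Rd d)) (f : Rd d → ℝ)
    (V : Submodule ℝ (Rd d → ℝ)) (v : Rd d → ℝ) : Prop :=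
  v ∈ V ∧ ∀ w ∈ V, form k D v w = ∫ x in D, f x * w x

/-- The sets `cell K` are the (open) cells of a partition of `D`. -/
def IsPartition {d : ℕ} {T : Type*} (D : Set (Rd d)) (cell : T → Set (Rd d)) : Prop :=
  (∀ K, IsOpen (cell K)) ∧ (∀ K, cell K ⊆ D) ∧
    (∀ K L, K ≠ L → Disjoint (cell K) (cell L)) ∧ volume (D \ ⋃ K, cell K) = 0

/-- The standard multiscale basis function on the cell `K` with boundary data `l`:
`-∇·(k∇φ) = 0` in `K` and `φ = l` on `∂K`. -/
def IsStdBasis {d : ℕ} (k : Rd d → ℝ) (K : Set (Rd d)) (l φ : Rd d → ℝ) : Prop :=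
  MemH1 K φ ∧ MemH10 K (fun x => φ x - l x) ∧
    ∀ w : Rd d → ℝ, MemH10 K w → form k K φ w = 0

/-- The function `p` is the projection `Πl ∈ H¹₀(K)` of `l` with respect to `(k₀ ∇·, ∇·)_K`. -/
def IsProjection {d : ℕ} (k₀ : Rd d → ℝ) (K : Set (Rd d)) (l p : Rd d → ℝ) : Prop :=
  MemH10 K p ∧ ∀ w : Rd d → ℝ, MemH10 K w → form k₀ K p w = form k₀ K l w

/-- The bubble functions `ξ 0, ξ 1, …` in `H¹₀(K)`, where `p = Πl`:
`-∇·(k₀∇ξ₀) = -∇·(k₁∇(Πl - l))` and `-∇·(k₀∇ξ_{j+1}) = ∇·(k₁∇ξ_j)` in `K`. -/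
def IsBubbleSeq {d : ℕ} (k₀ k₁ : Rd d → ℝ) (K : Set (Rd d)) (l p : Rd d → ℝ)
    (ξ : ℕ → Rd d → ℝ) : Prop :=
  (∀ j, MemH10 K (ξ j)) ∧
    (∀ w : Rd d → ℝ, MemH10 K w → form k₀ K (ξ 0) w = form k₁ K (fun x => p x - l x) w) ∧
    ∀ j, ∀ w : Rd d → ℝ, MemH10 K w → form k₀ K (ξ (j + 1)) w = -form k₁ K (ξ j) w

/-- The new multiscale basis function `φ_J = l - Πl + ∑_{j=0}^J ξ_j`, where `p = Πl`. -/
def newBasis {d : ℕ} (l p : Rd d → ℝ) (ξ : ℕ → Rd d → ℝ) (J : ℕ) : Rd d → ℝ :=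
  fun x => l x - p x + ∑ j ∈ Finset.range (J + 1), ξ j x

/-- The global function attached to the node `q`: on every cell `K` it is the sum of the local
functions `φ K i` over the local vertices `i` of `K` whose global node is `q`. -/
def assemble {d : ℕ} {T ι N : Type*} [Fintype T] [Fintype ι] [DecidableEq N]
    (cell : T → Set (Rd d)) (node : T → ι → N) (φ : T → ι → Rd d → ℝ) (q : N) : Rd d → ℝ :=
  fun x => ∑ K, ∑ i, if node K i = q then (cell K).indicator (φ K i) x else 0

/-- The finite element space spanned by the local functions `φ K i`, glued together at the
interior nodes of the mesh. -/
def feSpace {d : ℕ} {T ι N : Type*} [Fintype T] [Fintype ι] [DecidableEq N]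
    (cell : T → Set (Rd d)) (node : T → ι → N) (interiorNodes : Set N)
    (φ : T → ι → Rd d → ℝ) : Submodule ℝ (Rd d → ℝ) :=
  Submodule.span ℝ (assemble cell node φ '' interiorNodes)

/-- The constant `η = max_K ‖k₁/k₀‖_{L^∞(K)}`. -/
def eta {d : ℕ} {T : Type*} (cell : T → Set (Rd d)) (k₀ k₁ : Rd d → ℝ) : ℝ :=
  ⨆ K, linftyNorm (cell K) (fun x => k₁ x / k₀ x)

/-- The constant `c̃ = √2 max_K ‖√(k₀/k)‖_{L^∞(K)}`. -/
def cTilde {d : ℕ} {T : Type*} (cell : T → Set (Rd d)) (k k₀ : Rd d → ℝ) : ℝ :=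
  Real.sqrt 2 * ⨆ K, linftyNorm (cell K) (fun x => Real.sqrt (k₀ x / k x))

end

end MsFEM

namespace MsFEM

/-! ### Linear algebra: Neumann series and Galerkin comparison for two symmetric forms -/

section Abstract

variable {E : Type*} [AddCommGroup E] [Module ℝ E]

/-! Let B and C be the forms on H¹(D) with coefficients k₀ and k₁, let a = B + C be the energy form,
and let W be the space of functions that are bubbles on every cell. Gluing turns the cell problems
into orthogonality relations: v in V_h is a-orthogonal to W, while the function r glued from l - Πl
with the same coefficients is B-orthogonal to W and differs from v by an element of W. Hence B(v -
r, w) = -C(v, w) on W, and the bubbles ξ_j are the terms of the Neumann series for v - r. Each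
further term shrinks the energy norm of the remainder by the factor η (`energy_contraction`). Since
r minimises B among functions with its cell boundary values, the partner vJ of v satisfies |||v -
vJ||| ≤ c̃ η^(J+1) |||g||| for every g in v + W (`IsNeumannApprox.error_le`).

The partnership links V_h and V_{J,h} in both directions (`exists_mem_span_image_rel`). With ε =
η^(J+1), the second bound is Céa's lemma: u_{J,h} is at least as close to u as the partner of u_h
is. For the first, Galerkin orthogonality together with a-orthogonality to W rewrites |||u_h -
u_{J,h}|||² as pairings against the two partner errors (`galerkin_comparison`). These are linear in
c̃ε, whence the square root. The argument produces 2ε, which is at most ε + ε/(1 - ε). -/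

theorem bilin_cauchy_schwarz (a : LinearMap.BilinForm ℝ E) (hsymm : ∀ v w, a v w = a w v)
    (hnn : ∀ v, 0 ≤ a v v) (v w : E) : a v w ≤ √(a v v) * √(a w w) := by
  rw [← Real.sqrt_mul (hnn v)]
  refine Real.le_sqrt_of_sq_le ?_
  -- The form is only semidefinite; nonnegativity of the quadratic in t forces its discriminant to
  -- be nonpositive.
  have key : ∀ t : ℝ, 0 ≤ a w w * (t * t) + (2 * a v w) * t + a v v := by
    intro t
    have h := hnn (v + t • w)
    simp only [map_add, LinearMap.add_apply, map_smul, LinearMap.smul_apply, smul_eq_mul] at h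
    rw [hsymm w v] at h
    linarith
  have h := discrim_le_zero key
  unfold discrim at h
  nlinarith

theorem bilin_sqrt_add_le (a : LinearMap.BilinForm ℝ E) (hsymm : ∀ v w, a v w = a w v)
    (hnn : ∀ v, 0 ≤ a v v) (v w : E) :
    √(a (v + w) (v + w)) ≤ √(a v v) + √(a w w) := by
  refine Real.sqrt_le_iff.2 ⟨by positivity, ?_⟩
  have h := bilin_cauchy_schwarz a hsymm hnn v w
  have h1 := Real.sq_sqrt (hnn v)
  have h2 := Real.sq_sqrt (hnn w)
  simp only [map_add, LinearMap.add_apply]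
  rw [hsymm w v]
  nlinarith

/-- If `z` represents `±C(x, ·)` with respect to `B`, then the operator `x ↦ z` contracts the
energy of `B + C` by the relative size `η` of `C`. -/
theorem energy_contraction (B C : LinearMap.BilinForm ℝ E) (hB : ∀ v w, B v w = B w v)
    (hC : ∀ v w, C v w = C w v) {η : ℝ} (hη0 : 0 ≤ η) (hη1 : η < 1)
    (hCB : ∀ v, |C v v| ≤ η * B v v) (x z : E)
    (hx : B z x = -C x x) (hz : B z z = -C x z) :
    B z z + C z z ≤ η ^ 2 * (B x x + C x x) := by
  -- The upper bound at ηx - z and the lower bound at ηx + z combine by polarisation: C(x, z) =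
  -- -B(z, z) yields B(z, z) ≤ η² B(x, x) after cancelling 2η. The first bound alone gives C(z, z) -
  -- η² C(x, x) ≤ η (η² B(x, x) - B(z, z)), and η < 1 closes the estimate.
  have h1 := (abs_le.1 (hCB (η • x - z))).2
  have h2 := (abs_le.1 (hCB (η • x + z))).1
  simp only [map_add, LinearMap.add_apply, map_sub, LinearMap.sub_apply, map_smul,
    LinearMap.smul_apply, smul_eq_mul] at h1 h2
  rw [hB x z, hC z x, hx] at h1 h2
  have hxz : C x z = -B z z := by linarith
  rw [hxz] at h1 h2
  have key : B z z ≤ η ^ 2 * B x x := by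
    -- For η = 0 nothing can be cancelled; then C vanishes on the diagonal, so C(x, z) = 0 and B(z,
    -- z) = 0.
    rcases hη0.eq_or_lt with rfl | hpos
    · have a1 := hCB (x + z)
      have a2 := hCB x
      have a3 := hCB z
      simp only [map_add, LinearMap.add_apply, zero_mul, abs_nonpos_iff] at a1 a2 a3
      rw [hC z x, hxz] at a1
      nlinarith
    · have : 0 ≤ 2 * η * (η ^ 2 * B x x - B z z) := by nlinarith
      nlinarith [nonneg_of_mul_nonneg_right this (by positivity)]
  nlinarith [mul_nonneg (sub_nonneg.2 hη1.le) (sub_nonneg.2 key)]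

/-- The function `v` is `(B + C)`-harmonic with respect to the bubble space `W`, `r` is
`B`-harmonic with the same boundary data, and `vJ` is the corrected function obtained from `r` by
adding the first `J + 1` terms of the Neumann series `ξ`. -/
def IsNeumannApprox (B C : LinearMap.BilinForm ℝ E) (W : Submodule ℝ E) (J : ℕ)
    (v vJ : E) : Prop :=
  ∃ (r : E) (ξ : ℕ → E), v - r ∈ W ∧ (∀ j, ξ j ∈ W) ∧ (∀ w ∈ W, B v w + C v w = 0) ∧
    (∀ w ∈ W, B r w = 0) ∧ (∀ w ∈ W, B (ξ 0) w = -C r w) ∧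
    (∀ j, ∀ w ∈ W, B (ξ (j + 1)) w = -C (ξ j) w) ∧ vJ = r + ∑ j ∈ Finset.range (J + 1), ξ j

namespace IsNeumannApprox

variable {B C : LinearMap.BilinForm ℝ E} {W : Submodule ℝ E} {J : ℕ} {v vJ v' vJ' : E}

theorem zero : IsNeumannApprox B C W J 0 0 :=
  ⟨0, 0, by simp⟩

theorem add (h : IsNeumannApprox B C W J v vJ) (h' : IsNeumannApprox B C W J v' vJ') :
    IsNeumannApprox B C W J (v + v') (vJ + vJ') := by
  obtain ⟨r, ξ, h1, h2, h3, h4, h5, h6, h7⟩ := h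
  obtain ⟨r', ξ', h1', h2', h3', h4', h5', h6', h7'⟩ := h'
  refine ⟨r + r', ξ + ξ', ?_, fun j => W.add_mem (h2 j) (h2' j), fun w hw => ?_, fun w hw => ?_,
    fun w hw => ?_, fun j w hw => ?_, ?_⟩
  · rw [add_sub_add_comm]; exact W.add_mem h1 h1'
  · simp only [map_add, LinearMap.add_apply]; linarith [h3 w hw, h3' w hw]
  · simp only [map_add, LinearMap.add_apply]; linarith [h4 w hw, h4' w hw]
  · simp only [Pi.add_apply, map_add, LinearMap.add_apply]; linarith [h5 w hw, h5' w hw]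
  · simp only [Pi.add_apply, map_add, LinearMap.add_apply]; linarith [h6 j w hw, h6' j w hw]
  · simp only [Pi.add_apply, Finset.sum_add_distrib, h7, h7']; abel

theorem smul (t : ℝ) (h : IsNeumannApprox B C W J v vJ) :
    IsNeumannApprox B C W J (t • v) (t • vJ) := by
  obtain ⟨r, ξ, h1, h2, h3, h4, h5, h6, h7⟩ := h
  refine ⟨t • r, t • ξ, ?_, fun j => W.smul_mem t (h2 j), fun w hw => ?_, fun w hw => ?_,
    fun w hw => ?_, fun j w hw => ?_, ?_⟩
  · rw [← smul_sub]; exact W.smul_mem t h1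
  · simp only [map_smul, LinearMap.smul_apply, smul_eq_mul]; rw [← mul_add, h3 w hw, mul_zero]
  · simp only [map_smul, LinearMap.smul_apply, smul_eq_mul]; rw [h4 w hw, mul_zero]
  · simp only [Pi.smul_apply, map_smul, LinearMap.smul_apply, smul_eq_mul]; rw [h5 w hw]; ring
  · simp only [Pi.smul_apply, map_smul, LinearMap.smul_apply, smul_eq_mul]; rw [h6 j w hw]; ring
  · simp only [Pi.smul_apply, ← Finset.smul_sum, h7, smul_add]

theorem sub_mem (h : IsNeumannApprox B C W J v vJ) : v - vJ ∈ W := by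
  obtain ⟨r, ξ, h1, h2, h3, h4, h5, h6, rfl⟩ := h
  rw [← sub_sub]
  exact W.sub_mem h1 (W.sum_mem fun j _ => h2 j)

theorem orthogonal (h : IsNeumannApprox B C W J v vJ) {w : E} (hw : w ∈ W) :
    (B + C) v w = 0 := by
  obtain ⟨r, ξ, h1, h2, h3, -⟩ := h
  exact h3 w hw

/-- The truncation error of the Neumann series, relative to any function with the same boundary
data. -/
theorem error_le (h : IsNeumannApprox B C W J v vJ) (hB : ∀ v w, B v w = B w v)
    (hC : ∀ v w, C v w = C w v) {η : ℝ} (hη0 : 0 ≤ η) (hη1 : η < 1)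
    (hBnn : ∀ v, 0 ≤ B v v) (hCB : ∀ v, |C v v| ≤ η * B v v) {γ : ℝ}
    (hγ : ∀ v, B v v ≤ γ * (B + C) v v) (g : E) (hg : v - g ∈ W) :
    (B + C) (v - vJ) (v - vJ) ≤ (η ^ (J + 1)) ^ 2 * (2 * γ * (B + C) g g) := by
  obtain ⟨r, ξ, h1, h2, h3, h4, h5, h6, rfl⟩ := h
  have hsW : ∀ n, v - r - ∑ j ∈ Finset.range n, ξ j ∈ W := fun n =>
    W.sub_mem h1 (W.sum_mem fun j _ => h2 j)
  -- Successive remainders of the series stand in the relation required by `energy_contraction`,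
  -- tested on W, where all of them lie.
  have hrec : ∀ n, ∀ w ∈ W, B (v - r - ∑ j ∈ Finset.range (n + 1), ξ j) w =
      -C (v - r - ∑ j ∈ Finset.range n, ξ j) w := by
    intro n
    induction n with
    | zero =>
      intro w hw
      simp only [Finset.range_one, Finset.sum_singleton, zero_add, Finset.range_zero,
        Finset.sum_empty, sub_zero, map_sub, LinearMap.sub_apply]
      linarith [h3 w hw, h4 w hw, h5 w hw]
    | succ n ih =>
      intro w hw
      have := ih w hw
      rw [Finset.sum_range_succ, ← sub_sub, map_sub, LinearMap.sub_apply, this, h6 n w hw,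
        Finset.sum_range_succ _ n, ← sub_sub, map_sub C _ (ξ n), LinearMap.sub_apply]
      ring
  have hcontr : ∀ n, (B + C) (v - r - ∑ j ∈ Finset.range n, ξ j)
      (v - r - ∑ j ∈ Finset.range n, ξ j) ≤ (η ^ n) ^ 2 * (B + C) (v - r) (v - r) := by
    intro n
    induction n with
    | zero => simp
    | succ n ih =>
      refine (energy_contraction B C hB hC hη0 hη1 hCB _ _ (hrec n _ (hsW n))
        (hrec n _ (hsW (n + 1)))).trans ?_
      calc _ ≤ η ^ 2 * ((η ^ n) ^ 2 * (B + C) (v - r) (v - r)) :=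
            mul_le_mul_of_nonneg_left ih (by positivity)
        _ = _ := by ring
  have hann : ∀ x, 0 ≤ (B + C) x x := fun x => by
    have := (abs_le.1 (hCB x)).1
    have := mul_nonneg (sub_nonneg.2 hη1.le) (hBnn x)
    simp only [LinearMap.add_apply]
    linarith
  rw [← sub_sub]
  refine (hcontr (J + 1)).trans (mul_le_mul_of_nonneg_left ?_ (by positivity))
  -- Since v is a-orthogonal to v - r, the left side equals a(r, r) - a(v, v).
  have e1 : (B + C) (v - r) (v - r) ≤ (B + C) r r := by
    have h0 := h3 _ h1
    have hv := hann v
    simp only [map_sub, LinearMap.sub_apply, LinearMap.add_apply] at h0 hv ⊢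
    rw [hB r v, hC r v]
    linarith
  -- From C ≤ ηB ≤ B; this 2 is the source of the √2 in c̃.
  have e2 : (B + C) r r ≤ 2 * B r r := by
    have := (abs_le.1 (hCB r)).2
    have := mul_nonneg (sub_nonneg.2 hη1.le) (hBnn r)
    simp only [LinearMap.add_apply]
    linarith
  -- B-harmonicity makes r minimal in r + W, which contains g.
  have e3 : B r r ≤ B g g := by
    have hmem : g - r ∈ W := by
      have := W.sub_mem h1 hg
      rwa [sub_sub_sub_cancel_left] at this
    have h0 := h4 _ hmem
    have hp := hBnn (g - r)
    simp only [map_sub, LinearMap.sub_apply] at h0 hp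
    rw [hB g r] at hp
    linarith
  linarith [hγ g]

end IsNeumannApprox

/-- Pythagoras gives SM ≤ n²/2, and τ ≤ 1/2 gives S + τM ≤ 3n/2. The two summands are thus at most
τn²/2 and 3τn²/2, adding up to 2τn². -/
theorem galerkin_numeric_bound {S M m n τ : ℝ} (hM : 0 ≤ M) (hm : 0 ≤ m)
    (hτ : 0 ≤ τ) (hpyth : S ^ 2 + M ^ 2 = n ^ 2) (hmn : m ≤ n) (hSn : S ≤ n) (hMn : M ≤ n)
    (hle : τ ≤ 1 / 2) : S * (τ * M) + (S + τ * M) * (τ * m) ≤ 2 * τ * n ^ 2 := by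
  have hn : 0 ≤ n := hm.trans hmn
  have h1 : S * M ≤ n ^ 2 / 2 := by linarith [sq_nonneg (S - M)]
  have h2 : S * (τ * M) ≤ τ * (n ^ 2 / 2) := by
    calc S * (τ * M) = τ * (S * M) := by ring
      _ ≤ _ := mul_le_mul_of_nonneg_left h1 hτ
  have h3 : S + τ * M ≤ n + 1 / 2 * n :=
    add_le_add hSn (mul_le_mul hle hMn hM (by norm_num))
  have h4 : (S + τ * M) * (τ * m) ≤ (n + 1 / 2 * n) * (τ * n) :=
    mul_le_mul h3 (mul_le_mul_of_nonneg_left hmn hτ) (by positivity) (by linarith)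
  linarith

/-- Comparison of the two Galerkin solutions, in abstract form. -/
theorem galerkin_comparison (B C : LinearMap.BilinForm ℝ E) (W : Submodule ℝ E) (J : ℕ)
    (hB : ∀ v w, B v w = B w v) (hC : ∀ v w, C v w = C w v) {η : ℝ} (hη0 : 0 ≤ η) (hη1 : η < 1)
    (hBnn : ∀ v, 0 ≤ B v v) (hCB : ∀ v, |C v v| ≤ η * B v v) {c : ℝ} (hc : 0 ≤ c)
    (hγ : ∀ v, B v v ≤ c ^ 2 / 2 * (B + C) v v) (V VJ : Submodule ℝ E)
    (hV : ∀ v ∈ V, ∃ vJ ∈ VJ, IsNeumannApprox B C W J v vJ)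
    (hVJ : ∀ vJ ∈ VJ, ∃ v ∈ V, IsNeumannApprox B C W J v vJ)
    (u uh uJ : E) (huh : uh ∈ V) (huJ : uJ ∈ VJ) (hgal : ∀ w ∈ V, (B + C) uh w = (B + C) u w)
    (hgalJ : ∀ w ∈ VJ, (B + C) uJ w = (B + C) u w) :
    √((B + C) (uh - uJ) (uh - uJ)) ≤
        √c * √(η ^ (J + 1) + η ^ (J + 1) / (1 - η ^ (J + 1))) * √((B + C) u u) ∧
      √((B + C) (u - uJ) (u - uJ)) ≤
        √2 * c * (η ^ (J + 1) + η ^ (J + 1) / (1 - η ^ (J + 1))) * √((B + C) u u) +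
          2 * √((B + C) (u - uh) (u - uh)) := by
  have hann : ∀ x, 0 ≤ (B + C) x x := fun x => by
    have := (abs_le.1 (hCB x)).1
    have := mul_nonneg (sub_nonneg.2 hη1.le) (hBnn x)
    simp only [LinearMap.add_apply]
    linarith
  have hasymm : ∀ x y, (B + C) x y = (B + C) y x := fun x y => by
    simp only [LinearMap.add_apply, hB x y, hC x y]
  obtain ⟨vJ, hvJ, hN1⟩ := hV uh huh
  obtain ⟨w, hw, hN2⟩ := hVJ uJ huJ
  -- The comparison functions are the Galerkin solutions themselves: in the second bound g is uJ,
  -- not its partner w, so the error is controlled by the energy norm of uJ and hence by that of u.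
  have hd1 := hN1.error_le hB hC hη0 hη1 hBnn hCB hγ uh (by simp)
  have hd2 := hN2.error_le hB hC hη0 hη1 hBnn hCB hγ uJ hN2.sub_mem
  have o1 := hN1.orthogonal hN1.sub_mem
  have o2 := hN1.orthogonal hN2.sub_mem
  have o3 := hN2.orthogonal hN1.sub_mem
  clear hγ hCB hBnn hV hVJ
  generalize B + C = a at *
  set ε := η ^ (J + 1) with hε
  have hε0 : 0 ≤ ε := by positivity
  have hε1 : ε < 1 := pow_lt_one₀ hη0 hη1 (by simp)
  have hgeom : 2 * ε ≤ ε + ε / (1 - ε) := by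
    have : ε ≤ ε / (1 - ε) := by
      rw [le_div_iff₀ (by linarith)]
      exact mul_le_of_le_one_right hε0 (by linarith)
    linarith
  set n := √(a u u) with hn
  set S := √(a (u - uh) (u - uh)) with hS
  set M := √(a uh uh) with hM
  set m := √(a uJ uJ) with hm
  have hn2 : n ^ 2 = a u u := Real.sq_sqrt (hann _)
  have hS2 : S ^ 2 = a (u - uh) (u - uh) := Real.sq_sqrt (hann _)
  have hM2 : M ^ 2 = a uh uh := Real.sq_sqrt (hann _)
  have hm2 : m ^ 2 = a uJ uJ := Real.sq_sqrt (hann _)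
  have hn0 : 0 ≤ n := Real.sqrt_nonneg _
  have hS0 : 0 ≤ S := Real.sqrt_nonneg _
  have hM0 : 0 ≤ M := Real.sqrt_nonneg _
  have hm0 : 0 ≤ m := Real.sqrt_nonneg _
  have g1 := hgal _ huh
  have g2 := hgal _ hw
  have g3 := hgalJ _ huJ
  have g4 := hgalJ _ hvJ
  have hpyth : S ^ 2 + M ^ 2 = n ^ 2 := by
    rw [hS2, hM2, hn2]
    simp only [map_sub, LinearMap.sub_apply]
    rw [hasymm uh u]
    linarith
  have hmn : m ≤ n := by
    refine Real.sqrt_le_sqrt ?_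
    have := hann (u - uJ)
    simp only [map_sub, LinearMap.sub_apply] at this
    rw [hasymm uJ u] at this
    linarith
  have hSn : S ≤ n := (sq_le_sq₀ hS0 hn0).1 (by linarith only [hpyth, sq_nonneg M])
  have hMn : M ≤ n := (sq_le_sq₀ hM0 hn0).1 (by linarith only [hpyth, sq_nonneg S])
  set τ := c * ε with hτ
  have hτ0 : 0 ≤ τ := by positivity
  have hδ1 : √(a (uh - vJ) (uh - vJ)) ≤ τ * M := by
    refine Real.sqrt_le_iff.2 ⟨by positivity, ?_⟩
    rw [mul_pow, hM2, hτ]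
    linarith
  have hδ2 : √(a (w - uJ) (w - uJ)) ≤ τ * m := by
    refine Real.sqrt_le_iff.2 ⟨by positivity, ?_⟩
    rw [mul_pow, hm2, hτ]
    linarith
  constructor
  · rw [← Real.sqrt_mul hc, hn, ← Real.sqrt_mul (mul_nonneg hc (by linarith only [hε0, hgeom]))]
    refine Real.sqrt_le_sqrt ?_
    suffices h : a (uh - uJ) (uh - uJ) ≤ 2 * τ * a u u by
      refine h.trans (mul_le_mul_of_nonneg_right ?_ (hann u))
      calc 2 * τ = c * (2 * ε) := by rw [hτ]; ring
        _ ≤ _ := mul_le_mul_of_nonneg_left hgeom hc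
    rcases le_total τ (1 / 2) with hle | hge
    · have hid : a (uh - uJ) (uh - uJ) = a (u - uh) (uh - vJ) +
          a (-(u - uh - (uh - vJ))) (w - uJ) := by
        simp only [map_sub, map_neg, LinearMap.sub_apply, LinearMap.neg_apply] at o1 o2 o3 ⊢
        simp only [hasymm uJ uh, hasymm vJ uJ, hasymm vJ w, hasymm w uh] at g1 g2 g3 g4 o1 o2 o3 ⊢
        linarith
      have c1 := bilin_cauchy_schwarz a hasymm hann (u - uh) (uh - vJ)
      have c2 := bilin_cauchy_schwarz a hasymm hann (-(u - uh - (uh - vJ))) (w - uJ)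
      have c3 := bilin_sqrt_add_le a hasymm hann (u - uh) (-(uh - vJ))
      simp only [← sub_eq_add_neg, map_neg, LinearMap.neg_apply, neg_neg] at c2 c3
      rw [hid, ← hn2]
      have t1 : √(a (u - uh) (u - uh)) * √(a (uh - vJ) (uh - vJ)) ≤ S * (τ * M) :=
        mul_le_mul_of_nonneg_left hδ1 hS0
      have t2 : √(a (u - uh - (uh - vJ)) (u - uh - (uh - vJ))) * √(a (w - uJ) (w - uJ)) ≤
          (S + τ * M) * (τ * m) :=
        mul_le_mul (c3.trans (by linarith)) hδ2 (Real.sqrt_nonneg _) (by positivity)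
      have t3 := galerkin_numeric_bound hM0 hm0 hτ0 hpyth hmn hSn hMn hle
      simp only [map_neg, LinearMap.neg_apply] at c1 c2 ⊢
      linarith
    · have := hann (u - uh - uJ)
      have h1 : a (uh - uJ) (uh - uJ) ≤ a u u := by
        simp only [map_sub, LinearMap.sub_apply] at this ⊢
        simp only [hasymm uJ uh, hasymm uh u, hasymm uJ u] at this g1 g3 ⊢
        linarith
      exact h1.trans (le_mul_of_one_le_left (hann u) (by linarith only [hge]))
  · have hbest : √(a (u - uJ) (u - uJ)) ≤ √(a (u - vJ) (u - vJ)) := by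
      refine Real.sqrt_le_sqrt ?_
      have := hann (uJ - vJ)
      simp only [map_sub, LinearMap.sub_apply] at this ⊢
      simp only [hasymm vJ uJ, hasymm uJ u, hasymm vJ u] at this g3 g4 ⊢
      linarith
    have htri := bilin_sqrt_add_le a hasymm hann (u - uh) (uh - vJ)
    rw [sub_add_sub_cancel] at htri
    have h2 : 1 ≤ √2 := Real.one_le_sqrt.2 (by norm_num)
    have : τ * M ≤ √2 * c * (ε + ε / (1 - ε)) * n := by
      have : τ ≤ √2 * c * (ε + ε / (1 - ε)) := by
        calc τ = 1 * c * ε := by rw [hτ]; ring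
          _ ≤ _ := by gcongr; linarith
      gcongr
    linarith

end Abstract

/-! ### Weak gradients, H¹ and H¹₀, and extension by zero -/

section Sobolev

variable {d : ℕ} {U K D : Set (Rd d)} {v w : Rd d → ℝ} {g g' : Rd d → Rd d}

theorem gradient_coord (ψ : Rd d → ℝ) (x : Rd d) (i : Fin d) :
    gradient ψ x i = fderiv ℝ ψ x (EuclideanSpace.single i 1) := by
  rw [← inner_gradient_left, EuclideanSpace.inner_single_right]
  simp

theorem integrable_mul_of_memLp_two {α : Type*} {_ : MeasurableSpace α} {μ : Measure α}
    {f h : α → ℝ} (hf : MemLp f 2 μ) (hh : MemLp h 2 μ) : Integrable (fun x => f x * h x) μ :=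
  hf.integrable_mul hh

namespace IsTest

variable {ψ χ : Rd d → ℝ}

theorem mono (h : IsTest K ψ) (hKD : K ⊆ D) : IsTest D ψ :=
  ⟨h.1, h.2.1, h.2.2.trans hKD⟩

theorem eq_zero (h : IsTest U ψ) {x : Rd d} (hx : x ∉ U) : ψ x = 0 :=
  image_eq_zero_of_notMem_tsupport fun hx' => hx (h.2.2 hx')

theorem fderiv_eq_zero (h : IsTest U ψ) {x : Rd d} (hx : x ∉ U) : fderiv ℝ ψ x = 0 :=
  image_eq_zero_of_notMem_tsupport fun hx' => hx (h.2.2 (tsupport_fderiv_subset ℝ hx'))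

theorem gradient_eq_zero (h : IsTest U ψ) {x : Rd d} (hx : x ∉ U) : gradient ψ x = 0 := by
  simp [gradient, h.fderiv_eq_zero hx]

theorem continuous_fderiv (h : IsTest U ψ) : Continuous (fderiv ℝ ψ) :=
  h.1.continuous_fderiv (by simp)

theorem continuous_gradient (h : IsTest U ψ) : Continuous (gradient ψ) :=
  (LinearIsometryEquiv.continuous _).comp h.continuous_fderiv

theorem differentiable (h : IsTest U ψ) : Differentiable ℝ ψ :=
  h.1.differentiable (by simp)

theorem memLp (h : IsTest U ψ) (s : Set (Rd d)) : MemLp ψ 2 (volume.restrict s) :=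
  (h.1.continuous.memLp_of_hasCompactSupport h.2.1).restrict s

theorem hasCompactSupport_gradient (h : IsTest U ψ) : HasCompactSupport (gradient ψ) :=
  (h.2.1.fderiv ℝ).comp_left (g := (InnerProductSpace.toDual ℝ (Rd d)).symm) (map_zero _)

theorem memLp_gradient (h : IsTest U ψ) (s : Set (Rd d)) :
    MemLp (gradient ψ) 2 (volume.restrict s) :=
  (h.continuous_gradient.memLp_of_hasCompactSupport h.hasCompactSupport_gradient).restrict s

theorem memLp_gradient_coord (h : IsTest U ψ) (s : Set (Rd d)) (i : Fin d) :
    MemLp (fun x => gradient ψ x i) 2 (volume.restrict s) :=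
  (h.memLp_gradient s).continuousLinearMap_comp (EuclideanSpace.proj (𝕜 := ℝ) i)

theorem gradient_add (h : IsTest U ψ) (h' : IsTest U χ) (x : Rd d) :
    gradient (fun y => ψ y + χ y) x = gradient ψ x + gradient χ x := by
  rw [gradient, fderiv_fun_add (h.differentiable x) (h'.differentiable x), map_add]; rfl

theorem gradient_smul (h : IsTest U ψ) (t : ℝ) (x : Rd d) :
    gradient (fun y => t * ψ y) x = t • gradient ψ x := by
  rw [gradient, fderiv_const_mul (h.differentiable x), map_smulₛₗ]; rfl

theorem add (h : IsTest U ψ) (h' : IsTest U χ) : IsTest U (fun y => ψ y + χ y) :=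
  ⟨h.1.add h'.1, h.2.1.add h'.2.1,
    (tsupport_add ψ χ).trans (Set.union_subset h.2.2 h'.2.2)⟩

theorem smul (h : IsTest U ψ) (t : ℝ) : IsTest U (fun y => t * ψ y) :=
  ⟨contDiff_const.mul h.1, h.2.1.mul_left, (tsupport_mul_subset_right).trans h.2.2⟩

theorem zero : IsTest U (fun _ => 0) :=
  ⟨contDiff_const, HasCompactSupport.zero, by simp [tsupport]⟩

/-- Integration by parts for smooth compactly supported functions. -/
theorem integral_mul_gradient (h : IsTest K ψ) (h' : IsTest D χ) (i : Fin d) :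
    ∫ x in K, ψ x * gradient χ x i = -∫ x in K, gradient ψ x i * χ x := by
  rw [setIntegral_eq_integral_of_forall_compl_eq_zero fun x hx => by rw [h.eq_zero hx, zero_mul],
    setIntegral_eq_integral_of_forall_compl_eq_zero fun x hx => by
      rw [h.gradient_eq_zero hx]; simp]
  have m1 := h.memLp Set.univ
  have m2 := h'.memLp Set.univ
  have i1 := integrable_mul_of_memLp_two (h.memLp_gradient_coord Set.univ i) m2
  have i2 := integrable_mul_of_memLp_two m1 (h'.memLp_gradient_coord Set.univ i)
  have i3 := integrable_mul_of_memLp_two m1 m2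
  simp only [Measure.restrict_univ, gradient_coord] at i1 i2 i3 ⊢
  exact integral_mul_fderiv_eq_neg_fderiv_mul_of_integrable i1 i2 i3
    (fun x _ => h.differentiable x) (fun x _ => h'.differentiable x)

end IsTest

theorem tendsto_integral_mul_of_eLpNorm {μ : Measure (Rd d)} {F : ℕ → Rd d → ℝ} {h : Rd d → ℝ}
    (hF : ∀ n, MemLp (F n) 2 μ) (hlim : Tendsto (fun n => eLpNorm (F n) 2 μ) atTop (𝓝 0))
    (hh : MemLp h 2 μ) : Tendsto (fun n => ∫ x, F n x * h x ∂μ) atTop (𝓝 0) := by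
  rw [tendsto_zero_iff_enorm_tendsto_zero]
  have hb : ∀ n, ‖∫ x, F n x * h x ∂μ‖ₑ ≤ eLpNorm (F n) 2 μ * eLpNorm h 2 μ := fun n => by
    refine (enorm_integral_le_lintegral_enorm _).trans ?_
    rw [← eLpNorm_one_eq_lintegral_enorm]
    have := eLpNorm_smul_le_mul_eLpNorm (p := 2) (q := 2) (r := 1) hh.1 (hF n).1
    exact this
  refine tendsto_of_tendsto_of_tendsto_of_le_of_le tendsto_const_nhds ?_ (fun _ => zero_le) hb
  simpa using ENNReal.Tendsto.mul_const hlim (Or.inr hh.2.ne)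

namespace HasWeakGrad

theorem coord (h : HasWeakGrad U v g) (i : Fin d) :
    MemLp (fun x => g x i) 2 (volume.restrict U) :=
  h.1.continuousLinearMap_comp (EuclideanSpace.proj (𝕜 := ℝ) i)

/-- The fundamental lemma of the calculus of variations, coordinate by coordinate. It makes the
chosen `weakGrad` linear and local almost everywhere. -/
theorem unique (hU : IsOpen U) (h : HasWeakGrad U v g) (h' : HasWeakGrad U v g') :
    g =ᵐ[volume.restrict U] g' := by
  have key : ∀ i : Fin d, ∀ᵐ x, x ∈ U → g x i - g' x i = 0 := by
    intro i
    refine hU.ae_eq_zero_of_integral_contDiff_smul_eq_zero ?_ fun ψ h1 h2 h3 => ?_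
    · exact locallyIntegrableOn_of_locallyIntegrable_restrict
        (((h.coord i).sub (h'.coord i)).locallyIntegrable (by norm_num))
    have hψ : IsTest U ψ := ⟨h1, h2, h3⟩
    have e := (h.2 ψ hψ i).symm.trans (h'.2 ψ hψ i)
    rw [← setIntegral_eq_integral_of_forall_compl_eq_zero
      fun x hx => by rw [hψ.eq_zero hx, zero_smul]]
    have hi := integrable_mul_of_memLp_two (h.coord i) (hψ.memLp U)
    have hi' := integrable_mul_of_memLp_two (h'.coord i) (hψ.memLp U)
    calc ∫ x in U, ψ x • (g x i - g' x i)
        = ∫ x in U, g x i * ψ x - g' x i * ψ x := by congr with x; simp; ring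
      _ = 0 := by rw [integral_sub hi hi']; linarith
  rw [EventuallyEq, ae_restrict_iff' hU.measurableSet]
  filter_upwards [ae_all_iff.2 key] with x hx hxU
  ext i
  linarith [hx i hxU]

theorem congr (h : HasWeakGrad U v g) (hv : ∀ᵐ x ∂volume.restrict U, v x = w x)
    (hg : g =ᵐ[volume.restrict U] g') : HasWeakGrad U w g' := by
  refine ⟨h.1.ae_eq hg, fun ψ hψ i => ?_⟩
  rw [← integral_congr_ae (hg.mono fun x hx => by simp only [hx] : (fun x => g x i * ψ x)
      =ᵐ[volume.restrict U] fun x => g' x i * ψ x), ← h.2 ψ hψ i]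
  exact integral_congr_ae (hv.mono fun x hx => by simp only [hx])

theorem add (hv : MemLp v 2 (volume.restrict U)) (hw : MemLp w 2 (volume.restrict U))
    (h : HasWeakGrad U v g) (h' : HasWeakGrad U w g') :
    HasWeakGrad U (v + w) (g + g') := by
  refine ⟨h.1.add h'.1, fun ψ hψ i => ?_⟩
  have i1 := integrable_mul_of_memLp_two hv (hψ.memLp_gradient_coord U i)
  have i2 := integrable_mul_of_memLp_two hw (hψ.memLp_gradient_coord U i)
  have i3 := integrable_mul_of_memLp_two (h.coord i) (hψ.memLp U)
  have i4 := integrable_mul_of_memLp_two (h'.coord i) (hψ.memLp U)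
  simp only [Pi.add_apply, PiLp.add_apply, add_mul]
  rw [integral_add i1 i2, integral_add i3 i4, neg_add, ← h.2 ψ hψ i, ← h'.2 ψ hψ i]

theorem smul (t : ℝ) (h : HasWeakGrad U v g) : HasWeakGrad U (t • v) (t • g) := by
  refine ⟨h.1.const_smul t, fun ψ hψ i => ?_⟩
  simp only [Pi.smul_apply, PiLp.smul_apply, smul_eq_mul, mul_assoc, integral_const_mul,
    h.2 ψ hψ i, mul_neg]

theorem mono (hD : IsOpen D) (hKD : K ⊆ D) (h : HasWeakGrad D v g) :
    HasWeakGrad K v g := by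
  refine ⟨h.1.mono_measure (Measure.restrict_mono hKD le_rfl), fun ψ hψ i => ?_⟩
  rw [← setIntegral_eq_of_subset_of_forall_sdiff_eq_zero hD.measurableSet hKD
      fun x hx => by rw [hψ.gradient_eq_zero hx.2]; simp,
    ← setIntegral_eq_of_subset_of_forall_sdiff_eq_zero hD.measurableSet hKD
      fun x hx => by rw [hψ.eq_zero hx.2, mul_zero]]
  exact h.2 ψ (hψ.mono hKD) i

theorem zero : HasWeakGrad U 0 0 :=
  ⟨MemLp.zero, fun ψ _ i => by simp⟩

theorem ae_eq (hU : IsOpen U) (h : HasWeakGrad U v g) :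
    weakGrad U v =ᵐ[volume.restrict U] g := by
  have hex : ∃ g, HasWeakGrad U v g := ⟨g, h⟩
  rw [weakGrad, dif_pos hex]
  exact hex.choose_spec.unique hU h

end HasWeakGrad

namespace MemH1

theorem hasWeakGrad (h : MemH1 U v) : HasWeakGrad U v (weakGrad U v) := by
  rw [weakGrad, dif_pos h.2]
  exact h.2.choose_spec

theorem congr (h : MemH1 U v) (hU : IsOpen U) (hvw : ∀ x ∈ U, v x = w x) : MemH1 U w := by
  have hae : ∀ᵐ x ∂volume.restrict U, v x = w x := ae_restrict_of_forall_mem hU.measurableSet hvw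
  exact ⟨h.1.ae_eq hae, _, h.hasWeakGrad.congr hae .rfl⟩

theorem mono (h : MemH1 D v) (hD : IsOpen D) (hKD : K ⊆ D) : MemH1 K v :=
  ⟨h.1.mono_measure (Measure.restrict_mono hKD le_rfl), _, h.hasWeakGrad.mono hD hKD⟩

theorem weakGrad_mono (h : MemH1 D v) (hD : IsOpen D) (hK : IsOpen K) (hKD : K ⊆ D) :
    weakGrad K v =ᵐ[volume.restrict K] weakGrad D v :=
  (h.hasWeakGrad.mono hD hKD).ae_eq hK

theorem weakGrad_congr (h : MemH1 U v) (hU : IsOpen U) (hvw : ∀ x ∈ U, v x = w x) :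
    weakGrad U w =ᵐ[volume.restrict U] weakGrad U v :=
  (h.hasWeakGrad.congr (ae_restrict_of_forall_mem hU.measurableSet hvw) .rfl).ae_eq hU

theorem add (h : MemH1 U v) (h' : MemH1 U w) : MemH1 U (v + w) :=
  ⟨h.1.add h'.1, _, h.hasWeakGrad.add h.1 h'.1 h'.hasWeakGrad⟩

theorem smul (h : MemH1 U v) (t : ℝ) : MemH1 U (t • v) :=
  ⟨h.1.const_smul t, _, h.hasWeakGrad.smul t⟩

theorem weakGrad_add (h : MemH1 U v) (h' : MemH1 U w) (hU : IsOpen U) :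
    weakGrad U (v + w) =ᵐ[volume.restrict U] weakGrad U v + weakGrad U w :=
  (h.hasWeakGrad.add h.1 h'.1 h'.hasWeakGrad).ae_eq hU

theorem weakGrad_smul (h : MemH1 U v) (hU : IsOpen U) (t : ℝ) :
    weakGrad U (t • v) =ᵐ[volume.restrict U] t • weakGrad U v :=
  (h.hasWeakGrad.smul t).ae_eq hU

end MemH1

namespace MemH10

/-- Membership in `H¹₀(U)` can be tested with any representative of the weak gradient. -/
theorem of_tendsto (hU : IsOpen U) (hv : MemLp v 2 (volume.restrict U)) (hg : HasWeakGrad U v g)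
    (ψ : ℕ → Rd d → ℝ) (hψ : ∀ n, IsTest U (ψ n))
    (h1 : Tendsto (fun n => eLpNorm (v - ψ n) 2 (volume.restrict U)) atTop (𝓝 0))
    (h2 : Tendsto (fun n => eLpNorm (g - gradient (ψ n)) 2 (volume.restrict U)) atTop (𝓝 0)) :
    MemH10 U v := by
  refine ⟨⟨hv, g, hg⟩, ψ, hψ, h1, h2.congr fun n => eLpNorm_congr_ae ?_⟩
  filter_upwards [hg.ae_eq hU] with x hx
  simp [hx]

theorem congr (h : MemH10 U v) (hU : IsOpen U) (hvw : ∀ x ∈ U, v x = w x) : MemH10 U w := by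
  obtain ⟨h0, ψ, hψ, h1, h2⟩ := h
  have hae : ∀ᵐ x ∂volume.restrict U, v x = w x := ae_restrict_of_forall_mem hU.measurableSet hvw
  refine of_tendsto hU (h0.congr hU hvw).1 (h0.hasWeakGrad.congr hae .rfl) ψ hψ
    (h1.congr fun n => eLpNorm_congr_ae ?_) h2
  filter_upwards [hae] with x hx
  simp [hx]

theorem zero (hU : IsOpen U) : MemH10 U (0 : Rd d → ℝ) := by
  refine of_tendsto hU MemLp.zero .zero (fun _ _ => 0) (fun _ => .zero) ?_ ?_
  · have : (0 : Rd d → ℝ) - (fun _ => 0) = 0 := by ext x; simp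
    simp only [this, eLpNorm_zero]
    exact tendsto_const_nhds
  · have : gradient (fun _ : Rd d => (0 : ℝ)) = 0 := by ext x; simp [gradient]
    simp [this]

theorem add (hU : IsOpen U) (h : MemH10 U v) (h' : MemH10 U w) : MemH10 U (v + w) := by
  obtain ⟨h0, ψ, hψ, h1, h2⟩ := h
  obtain ⟨h0', ψ', hψ', h1', h2'⟩ := h'
  refine of_tendsto hU (h0.add h0').1 (h0.hasWeakGrad.add h0.1 h0'.1 h0'.hasWeakGrad)
    (fun n x => ψ n x + ψ' n x) (fun n => (hψ n).add (hψ' n)) ?_ ?_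
  · have := h1.add h1'
    rw [add_zero] at this
    refine tendsto_of_tendsto_of_tendsto_of_le_of_le tendsto_const_nhds this
      (fun _ => zero_le) fun n => ?_
    refine le_of_eq_of_le (congrArg (eLpNorm · 2 _) ?_) (eLpNorm_add_le
      (h0.1.sub ((hψ n).memLp U)).1 (h0'.1.sub ((hψ' n).memLp U)).1 (by norm_num))
    ext x
    simp only [Pi.add_apply, Pi.sub_apply]
    ring
  · have := h2.add h2'
    rw [add_zero] at this
    refine tendsto_of_tendsto_of_tendsto_of_le_of_le tendsto_const_nhds this
      (fun _ => zero_le) fun n => ?_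
    refine le_of_eq_of_le (congrArg (eLpNorm · 2 _) ?_) (eLpNorm_add_le
      (h0.hasWeakGrad.1.sub ((hψ n).memLp_gradient U)).1
      (h0'.hasWeakGrad.1.sub ((hψ' n).memLp_gradient U)).1 (by norm_num))
    funext x
    simp only [Pi.add_apply, Pi.sub_apply, (hψ n).gradient_add (hψ' n)]
    abel

theorem smul (hU : IsOpen U) (h : MemH10 U v) (t : ℝ) : MemH10 U (t • v) := by
  obtain ⟨h0, ψ, hψ, h1, h2⟩ := h
  refine of_tendsto hU (h0.smul t).1 (h0.hasWeakGrad.smul t)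
    (fun n x => t * ψ n x) (fun n => (hψ n).smul t) ?_ ?_
  · have := ENNReal.Tendsto.const_mul (a := ‖t‖ₑ) h1 (Or.inr enorm_ne_top)
    rw [mul_zero] at this
    refine this.congr fun n => ?_
    rw [← eLpNorm_const_smul]
    congr 1
    ext x
    simp only [Pi.smul_apply, Pi.sub_apply, smul_eq_mul]
    ring
  · have := ENNReal.Tendsto.const_mul (a := ‖t‖ₑ) h2 (Or.inr enorm_ne_top)
    rw [mul_zero] at this
    refine this.congr fun n => ?_
    rw [← eLpNorm_const_smul]
    congr 1
    funext x
    simp only [Pi.smul_apply, Pi.sub_apply, (hψ n).gradient_smul, smul_sub]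

/-- Extension by zero maps `H¹₀(K)` into `H¹₀(D)`. -/
theorem indicator (hK : IsOpen K) (hD : IsOpen D) (hKD : K ⊆ D) (h : MemH10 K v) :
    MemH10 D (K.indicator v) := by
  obtain ⟨h0, ψ, hψ, h1, h2⟩ := h
  have hmK := hK.measurableSet
  have hres : (volume.restrict D).restrict K = (volume : Measure (Rd d)).restrict K := by
    rw [Measure.restrict_restrict hmK, Set.inter_eq_left.2 hKD]
  refine of_tendsto hD (g := K.indicator (weakGrad K v)) ?_ ⟨?_, fun χ hχ i => ?_⟩ ψ
    (fun n => (hψ n).mono hKD) ?_ ?_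
  · rw [memLp_indicator_iff_restrict hmK, hres]
    exact h0.1
  · rw [memLp_indicator_iff_restrict hmK, hres]
    exact h0.hasWeakGrad.1
  · have e1 : ∫ x in D, K.indicator v x * gradient χ x i = ∫ x in K, v x * gradient χ x i := by
      rw [setIntegral_eq_of_subset_of_forall_sdiff_eq_zero hD.measurableSet hKD
        fun x hx => by rw [Set.indicator_of_notMem hx.2, zero_mul]]
      exact setIntegral_congr_fun hmK fun x hx => by simp only [Set.indicator_of_mem hx]
    have e2 : ∫ x in D, K.indicator (weakGrad K v) x i * χ x =
        ∫ x in K, weakGrad K v x i * χ x := by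
      rw [setIntegral_eq_of_subset_of_forall_sdiff_eq_zero hD.measurableSet hKD
        fun x hx => by rw [Set.indicator_of_notMem hx.2]; simp]
      exact setIntegral_congr_fun hmK fun x hx => by simp only [Set.indicator_of_mem hx]
    rw [e1, e2]
    have l1 := tendsto_integral_mul_of_eLpNorm (fun n => h0.1.sub ((hψ n).memLp K)) h1
      (hχ.memLp_gradient_coord K i)
    have hcoord : ∀ n, MemLp (fun x => weakGrad K v x i - gradient (ψ n) x i) 2
        (volume.restrict K) :=
      fun n => (h0.hasWeakGrad.coord i).sub ((hψ n).memLp_gradient_coord K i)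
    have l2 := tendsto_integral_mul_of_eLpNorm hcoord
      (tendsto_of_tendsto_of_tendsto_of_le_of_le tendsto_const_nhds h2 (fun _ => zero_le)
        fun n => eLpNorm_mono fun x => by
          rw [← PiLp.sub_apply]; exact PiLp.norm_apply_le _ i) (hχ.memLp K)
    have l3 := l1.add l2
    rw [add_zero] at l3
    -- Integration by parts cancels the ψ n contributions, so this sequence is constant; its limit
    -- is 0, which is the weak gradient identity for the extension.
    have hconst : ∀ n, (∫ x in K, (v - ψ n) x * gradient χ x i) +
        ∫ x in K, (weakGrad K v x i - gradient (ψ n) x i) * χ x =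
        (∫ x in K, v x * gradient χ x i) + ∫ x in K, weakGrad K v x i * χ x := fun n => by
      simp only [Pi.sub_apply, sub_mul]
      have m1 := hχ.memLp K
      have m2 := hχ.memLp_gradient_coord K i
      rw [integral_sub (integrable_mul_of_memLp_two h0.1 m2)
          (integrable_mul_of_memLp_two ((hψ n).memLp K) m2),
        integral_sub (integrable_mul_of_memLp_two (h0.hasWeakGrad.coord i) m1)
          (integrable_mul_of_memLp_two ((hψ n).memLp_gradient_coord K i) m1),
        (hψ n).integral_mul_gradient hχ i]
      ring
    have := tendsto_nhds_unique (l3.congr hconst) tendsto_const_nhds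
    linarith
  · refine h1.congr fun n => ?_
    rw [← hres, ← eLpNorm_indicator_eq_eLpNorm_restrict hmK]
    congr 1
    ext x
    by_cases hx : x ∈ K
    · simp [hx]
    · simp [hx, (hψ n).eq_zero hx]
  · refine h2.congr fun n => ?_
    rw [← hres, ← eLpNorm_indicator_eq_eLpNorm_restrict hmK]
    congr 1
    funext x
    by_cases hx : x ∈ K
    · simp [hx]
    · simp [hx, (hψ n).gradient_eq_zero hx]

end MemH10

/-- The space `H¹(U)` as a submodule of the space of all functions. -/
def H1 (U : Set (Rd d)) : Submodule ℝ (Rd d → ℝ) where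
  carrier := {v | MemH1 U v}
  zero_mem' := ⟨MemLp.zero, 0, .zero⟩
  add_mem' := MemH1.add
  smul_mem' t _ h := MemH1.smul h t

/-- The space `H¹₀(U)` as a submodule of the space of all functions. -/
def H10 (U : Set (Rd d)) (hU : IsOpen U) : Submodule ℝ (Rd d → ℝ) where
  carrier := {v | MemH10 U v}
  zero_mem' := MemH10.zero hU
  add_mem' := MemH10.add hU
  smul_mem' t _ h := MemH10.smul hU h t

end Sobolev

/-! ### Energy forms, coefficient bounds and their localisation to cells -/

section Forms

variable {d : ℕ} {U K D : Set (Rd d)} {c c' : Rd d → ℝ} {v w v' : Rd d → ℝ}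

/-- A bounded measurable coefficient on `U`. -/
structure IsBddCoeff (U : Set (Rd d)) (c : Rd d → ℝ) : Prop where
  aestronglyMeasurable : AEStronglyMeasurable c (volume.restrict U)
  exists_bound : ∃ M, ∀ x ∈ U, ‖c x‖ ≤ M

theorem IsBddCoeff.mono (h : IsBddCoeff D c) (hKD : K ⊆ D) : IsBddCoeff K c :=
  ⟨h.1.mono_measure (Measure.restrict_mono hKD le_rfl),
    h.2.imp fun _ hM x hx => hM x (hKD hx)⟩

theorem integrable_mul_inner (hU : IsOpen U) (hc : IsBddCoeff U c) {g g' : Rd d → Rd d}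
    (hg : MemLp g 2 (volume.restrict U)) (hg' : MemLp g' 2 (volume.restrict U)) :
    Integrable (fun x => c x * inner ℝ (g x) (g' x)) (volume.restrict U) := by
  obtain ⟨M, hM⟩ := hc.2
  have hi : Integrable (fun x => inner ℝ (g x) (g' x)) (volume.restrict U) :=
    (integrable_mul_of_memLp_two hg.norm hg'.norm).mono' (hg.1.inner hg'.1)
      (ae_of_all _ fun x => norm_inner_le_norm _ _)
  exact hi.bdd_mul hc.1 (ae_restrict_of_forall_mem hU.measurableSet hM)

theorem MemH1.integrable_form (hU : IsOpen U) (hc : IsBddCoeff U c) (hv : MemH1 U v)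
    (hw : MemH1 U w) :
    Integrable (fun x => c x * inner ℝ (weakGrad U v x) (weakGrad U w x)) (volume.restrict U) :=
  integrable_mul_inner hU hc hv.hasWeakGrad.1 hw.hasWeakGrad.1

theorem form_comm (c : Rd d → ℝ) (U : Set (Rd d)) (v w : Rd d → ℝ) :
    form c U v w = form c U w v := by
  simp only [form, real_inner_comm]

theorem form_add_left (hU : IsOpen U) (hc : IsBddCoeff U c) (hv : MemH1 U v) (hv' : MemH1 U v')
    (hw : MemH1 U w) : form c U (v + v') w = form c U v w + form c U v' w := by
  rw [form, form, form, ← integral_add (hv.integrable_form hU hc hw)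
    (hv'.integrable_form hU hc hw)]
  refine integral_congr_ae ?_
  filter_upwards [hv.weakGrad_add hv' hU] with x hx
  rw [hx, Pi.add_apply, inner_add_left, mul_add]

theorem form_smul_left (hU : IsOpen U) (t : ℝ) (hv : MemH1 U v) :
    form c U (t • v) w = t * form c U v w := by
  rw [form, form, ← integral_const_mul]
  refine integral_congr_ae ?_
  filter_upwards [hv.weakGrad_smul hU t] with x hx
  rw [hx, Pi.smul_apply, real_inner_smul_left]
  ring

theorem form_neg_left (hU : IsOpen U) (hv : MemH1 U v) :
    form c U (-v) w = -form c U v w := by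
  simpa using form_smul_left (c := c) (w := w) hU (-1) hv

/-- The form `(c ∇v, ∇w)_U` as a bilinear form on `H¹(U)`. -/
noncomputable def formBilin (hU : IsOpen U) (hc : IsBddCoeff U c) : LinearMap.BilinForm ℝ (H1 U) :=
  LinearMap.mk₂ ℝ (fun v w => form c U v w)
    (fun v v' w => form_add_left hU hc v.2 v'.2 w.2)
    (fun t v _ => form_smul_left hU t v.2)
    (fun v w w' => by
      simp only [form_comm c U v.1]
      exact form_add_left hU hc w.2 w'.2 v.2)
    (fun t v w => by
      simp only [form_comm c U v.1]
      exact form_smul_left hU t w.2)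

theorem formBilin_apply (hU : IsOpen U) (hc : IsBddCoeff U c) (v w : H1 U) :
    formBilin hU hc v w = form c U v w := rfl

theorem form_congr_left (hU : IsOpen U) (hv : MemH1 U v) (h : ∀ x ∈ U, v x = v' x) :
    form c U v' w = form c U v w := by
  refine integral_congr_ae ?_
  filter_upwards [hv.weakGrad_congr hU h] with x hx
  rw [hx]

theorem form_coeff_add (hU : IsOpen U) (hc : IsBddCoeff U c) (hc' : IsBddCoeff U c')
    {k : Rd d → ℝ} (hk : ∀ x ∈ U, k x = c x + c' x) (hv : MemH1 U v) (hw : MemH1 U w) :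
    form k U v w = form c U v w + form c' U v w := by
  rw [form, form, form, ← integral_add (hv.integrable_form hU hc hw)
    (hv.integrable_form hU hc' hw)]
  exact setIntegral_congr_fun hU.measurableSet fun x hx => by
    rw [hk x hx, add_mul]

theorem form_self_mono (hU : IsOpen U) (hc : IsBddCoeff U c) (hc' : IsBddCoeff U c') (t : ℝ)
    (h : ∀ᵐ x ∂volume.restrict U, c x ≤ t * c' x) (hv : MemH1 U v) :
    form c U v v ≤ t * form c' U v v := by
  rw [form, form, ← integral_const_mul]
  refine integral_mono_ae (hv.integrable_form hU hc hv)
    ((hv.integrable_form hU hc' hv).const_mul t) ?_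
  filter_upwards [h] with x hx
  rw [← mul_assoc]
  exact mul_le_mul_of_nonneg_right hx real_inner_self_nonneg

theorem form_self_nonneg (hU : IsOpen U) (hc : ∀ x ∈ U, 0 ≤ c x) : 0 ≤ form c U v v :=
  setIntegral_nonneg hU.measurableSet fun x hx => mul_nonneg (hc x hx) real_inner_self_nonneg

section Partition

variable {T : Type*} {cell : T → Set (Rd d)}

theorem IsPartition.restrict_eq (h : IsPartition D cell) :
    (volume : Measure (Rd d)).restrict D = volume.restrict (⋃ K, cell K) :=
  Measure.restrict_congr_set ((ae_le_set.2 h.2.2.2).antisymm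
    (LE.le.eventuallyLE (Set.iUnion_subset h.2.1)))

theorem form_eq_sum [Fintype T] (hD : IsOpen D) (h : IsPartition D cell) (hc : IsBddCoeff D c)
    (hv : MemH1 D v) (hw : MemH1 D w) : form c D v w = ∑ K, form c (cell K) v w := by
  rw [form, h.restrict_eq, integral_iUnion_fintype (fun K => (h.1 K).measurableSet)
    (fun K L hKL => h.2.2.1 K L hKL)
    (fun K => (hv.integrable_form hD hc hw).mono_measure (Measure.restrict_mono (h.2.1 K) le_rfl))]
  refine Finset.sum_congr rfl fun K _ => integral_congr_ae ?_
  filter_upwards [hv.weakGrad_mono hD (h.1 K) (h.2.1 K),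
    hw.weakGrad_mono hD (h.1 K) (h.2.1 K)] with x hx hx'
  rw [hx, hx']

theorem linftyNorm_nonneg (U : Set (Rd d)) (c : Rd d → ℝ) : 0 ≤ linftyNorm U c :=
  ENNReal.toReal_nonneg

theorem ae_norm_le_linftyNorm (hU : IsOpen U) {M : ℝ} (hM : ∀ x ∈ U, ‖c x‖ ≤ M) :
    ∀ᵐ x ∂volume.restrict U, ‖c x‖ ≤ linftyNorm U c := by
  -- Finiteness matters: `toReal` would send an infinite norm to 0.
  have hfin : eLpNorm c ⊤ (volume.restrict U) ≠ ⊤ := by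
    have hb := eLpNorm_le_of_ae_bound (p := ⊤)
      (ae_restrict_of_forall_mem (μ := volume) hU.measurableSet hM)
    simp only [ENNReal.toReal_top, inv_zero, ENNReal.rpow_zero, one_mul] at hb
    exact (hb.trans_lt ENNReal.ofReal_lt_top).ne
  filter_upwards [enorm_ae_le_eLpNormEssSup c (volume.restrict U)] with x hx
  rw [← eLpNorm_exponent_top] at hx
  rw [← toReal_enorm]
  exact ENNReal.toReal_mono hfin hx

theorem IsPartition.ae_norm_le_iSup [Finite T] (h : IsPartition D cell) {M : ℝ}
    (hM : ∀ x ∈ D, ‖c x‖ ≤ M) :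
    ∀ᵐ x ∂volume.restrict D, ‖c x‖ ≤ ⨆ K, linftyNorm (cell K) c := by
  rw [h.restrict_eq, ae_restrict_iUnion_iff]
  intro K
  filter_upwards [ae_norm_le_linftyNorm (h.1 K) fun x hx => hM x (h.2.1 K hx)] with x hx
  exact hx.trans (le_ciSup (f := fun K => linftyNorm (cell K) c) (Set.finite_range _).bddAbove K)

end Partition

/-! ### Gluing local functions at a node -/

section Assemble

variable {T ι N : Type*} [Fintype T] [Fintype ι] [DecidableEq N] {cell : T → Set (Rd d)}
  {node : T → ι → N} {q : N} {ψ χ : T → ι → Rd d → ℝ}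

theorem assemble_apply_of_mem (h : IsPartition D cell) {K : T} {x : Rd d} (hx : x ∈ cell K) :
    assemble cell node ψ q x = (∑ i, if node K i = q then ψ K i else 0) x := by
  classical
  rw [assemble, Finset.sum_eq_single K]
  · rw [Finset.sum_apply]
    refine Finset.sum_congr rfl fun i _ => ?_
    split_ifs <;> simp [hx]
  · intro L _ hL
    refine Finset.sum_eq_zero fun i _ => ?_
    rw [Set.indicator_of_notMem (Set.disjoint_right.1 (h.2.2.1 L K hL) hx), ite_self]
  · simp

theorem assemble_eq_sum :
    assemble cell node ψ q =
      ∑ K, ∑ i, if node K i = q then (cell K).indicator (ψ K i) else 0 := by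
  ext x
  simp only [assemble, Finset.sum_apply]
  refine Finset.sum_congr rfl fun K _ => Finset.sum_congr rfl fun i _ => ?_
  split_ifs <;> rfl

theorem assemble_add :
    assemble cell node (fun K i => ψ K i + χ K i) q =
      assemble cell node ψ q + assemble cell node χ q := by
  simp only [assemble_eq_sum, ← Finset.sum_add_distrib]
  refine Finset.sum_congr rfl fun K _ => Finset.sum_congr rfl fun i _ => ?_
  split_ifs
  · exact Set.indicator_add _ _ _
  · simp

theorem assemble_sub :
    assemble cell node (fun K i => ψ K i - χ K i) q =
      assemble cell node ψ q - assemble cell node χ q := by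
  rw [eq_sub_iff_add_eq, ← assemble_add]
  simp

theorem assemble_sum (ξ : ℕ → T → ι → Rd d → ℝ) (n : ℕ) :
    assemble cell node (fun K i => ∑ j ∈ Finset.range n, ξ j K i) q =
      ∑ j ∈ Finset.range n, assemble cell node (ξ j) q := by
  induction n with
  | zero =>
    ext x
    simp [assemble]
  | succ n ih => simp only [Finset.sum_range_succ, assemble_add, ih]

theorem memH10_assemble (hD : IsOpen D) (h : IsPartition D cell)
    (hψ : ∀ K i, MemH10 (cell K) (ψ K i)) : MemH10 D (assemble cell node ψ q) := by
  rw [assemble_eq_sum]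
  refine (H10 D hD).sum_mem fun K _ => (H10 D hD).sum_mem fun i _ => ?_
  split_ifs
  · exact (hψ K i).indicator (h.1 K) hD (h.2.1 K)
  · exact zero_mem _

theorem memH10_cell_assemble (h : IsPartition D cell)
    (hψ : ∀ K i, MemH10 (cell K) (ψ K i)) (K : T) :
    MemH10 (cell K) (assemble cell node ψ q) := by
  refine MemH10.congr (v := ∑ i, if node K i = q then ψ K i else 0) ?_ (h.1 K)
    fun x hx => (assemble_apply_of_mem h hx).symm
  refine (H10 (cell K) (h.1 K)).sum_mem fun i _ => ?_
  split_ifs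
  · exact hψ K i
  · exact zero_mem _

/-- Passes from the cell problems to the global form: cells cover D up to a null set, and on each
one the glued function is a finite sum of local functions. -/
theorem form_assemble_left (hD : IsOpen D) (h : IsPartition D cell) (hc : IsBddCoeff D c)
    (hψ : ∀ K i, MemH1 (cell K) (ψ K i)) (hA : MemH1 D (assemble cell node ψ q))
    (hw : MemH1 D w) :
    form c D (assemble cell node ψ q) w =
      ∑ K, ∑ i, if node K i = q then form c (cell K) (ψ K i) w else 0 := by
  rw [form_eq_sum hD h hc hA hw]
  refine Finset.sum_congr rfl fun K _ => ?_
  have hmem : ∀ i, (if node K i = q then ψ K i else 0) ∈ H1 (cell K) := fun i => by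
    split_ifs
    · exact hψ K i
    · exact zero_mem _
  rw [form_congr_left (h.1 K) ((H1 (cell K)).sum_mem fun i _ => hmem i)
    fun x hx => (assemble_apply_of_mem h hx).symm]
  have hlin := map_sum (formBilin (h.1 K) (hc.mono (h.2.1 K)) ⟨w, hw.mono hD (h.2.1 K)⟩)
    (fun i => (⟨_, hmem i⟩ : H1 (cell K))) Finset.univ
  simp only [formBilin_apply, AddSubmonoidClass.coe_finsetSum] at hlin
  rw [form_comm, hlin]
  refine Finset.sum_congr rfl fun i _ => ?_
  rw [form_comm]
  split_ifs
  · rfl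
  · simpa using form_smul_left (c := c) (w := w) (h.1 K) 0 (hψ K i)

end Assemble

end Forms

/-- A relation compatible with linear combinations extends from generators to spans. A relation
avoids choosing a linear map on generators that may be dependent, and it can be read in either
direction. -/
theorem exists_mem_span_image_rel {N E : Type*} [AddCommGroup E] [Module ℝ E]
    {R : E → E → Prop} (hzero : R 0 0) (hadd : ∀ x x' y y', R x y → R x' y' → R (x + x') (y + y'))
    (hsmul : ∀ (t : ℝ) x y, R x y → R (t • x) (t • y)) {s : Set N} {f g : N → E}
    (h : ∀ q ∈ s, R (f q) (g q)) :
    ∀ x ∈ Submodule.span ℝ (f '' s), ∃ y ∈ Submodule.span ℝ (g '' s), R x y := by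
  intro x hx
  induction hx using Submodule.span_induction with
  | mem x hx =>
    obtain ⟨q, hq, rfl⟩ := hx
    exact ⟨g q, Submodule.subset_span ⟨q, hq, rfl⟩, h q hq⟩
  | zero => exact ⟨0, zero_mem _, hzero⟩
  | add x x' _ _ ih ih' =>
    obtain ⟨y, hy, hxy⟩ := ih
    obtain ⟨y', hy', hxy'⟩ := ih'
    exact ⟨y + y', add_mem hy hy', hadd _ _ _ _ hxy hxy'⟩
  | smul t x _ ih =>
    obtain ⟨y, hy, hxy⟩ := ih
    exact ⟨t • y, Submodule.smul_mem _ t hy, hsmul _ _ _ hxy⟩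

/-! ### From the cell problems to the abstract hypotheses -/

section Comparison

variable {d : ℕ} {D : Set (Rd d)} {k k₀ k₁ : Rd d → ℝ} {T ι N : Type*}
  {cell : T → Set (Rd d)} {node : T → ι → N} {q : N}

/-- The functions in `H¹₀(D)` which belong to `H¹₀(K)` on every cell `K`. -/
def bubbleSpace (hD : IsOpen D) (h : IsPartition D cell) : Submodule ℝ (H1 D) :=
  (H10 D hD ⊓ ⨅ K, H10 (cell K) (h.1 K)).comap (H1 D).subtype

theorem mem_bubbleSpace {hD : IsOpen D} {h : IsPartition D cell} {w : H1 D} :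
    w ∈ bubbleSpace hD h ↔ MemH10 D w ∧ ∀ K, MemH10 (cell K) w := by
  simp only [bubbleSpace, Submodule.mem_comap, Submodule.mem_inf, Submodule.mem_iInf]
  rfl

theorem eta_nonneg (cell : T → Set (Rd d)) (k₀ k₁ : Rd d → ℝ) : 0 ≤ eta cell k₀ k₁ :=
  Real.iSup_nonneg fun K => linftyNorm_nonneg (cell K) _

theorem cTilde_nonneg (cell : T → Set (Rd d)) (k k₀ : Rd d → ℝ) : 0 ≤ cTilde cell k k₀ :=
  mul_nonneg (Real.sqrt_nonneg 2) (Real.iSup_nonneg fun K => linftyNorm_nonneg (cell K) _)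

variable [Fintype T] [Fintype ι] [DecidableEq N]

/-- The nodal functions of the standard and of the new method are related by the Neumann
series. -/
theorem isNeumannApprox_assemble (hD : IsOpen D) (h : IsPartition D cell)
    (hc₀ : IsBddCoeff D k₀) (hc₁ : IsBddCoeff D k₁) (hsplit : ∀ x ∈ D, k x = k₀ x + k₁ x)
    {l φ p : T → ι → Rd d → ℝ} {ξ : T → ι → ℕ → Rd d → ℝ}
    (hl : ∀ K i, MemH1 (cell K) (l K i)) (hconf : MemH10 D (assemble cell node l q))
    (hφ : ∀ K i, IsStdBasis k (cell K) (l K i) (φ K i))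
    (hp : ∀ K i, IsProjection k₀ (cell K) (l K i) (p K i))
    (hξ : ∀ K i, IsBubbleSeq k₀ k₁ (cell K) (l K i) (p K i) (ξ K i)) (J : ℕ) :
    ∃ (hA : MemH10 D (assemble cell node φ q))
      (hB : MemH10 D (assemble cell node (fun K i => newBasis (l K i) (p K i) (ξ K i) J) q)),
      IsNeumannApprox (formBilin hD hc₀) (formBilin hD hc₁) (bubbleSpace hD h) J
        ⟨_, hA.1⟩ ⟨_, hB.1⟩ := by
  have hAp : MemH10 D (assemble cell node p q) := memH10_assemble hD h fun K i => (hp K i).1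
  have hAξ : ∀ j, MemH10 D (assemble cell node (fun K i => ξ K i j) q) :=
    fun j => memH10_assemble hD h fun K i => (hξ K i).1 j
  have hφl : ∀ K i, MemH10 (cell K) (φ K i - l K i) := fun K i => (hφ K i).2.1
  have hr : ∀ K i, MemH1 (cell K) (l K i - p K i) :=
    fun K i => (H1 (cell K)).sub_mem (hl K i) (hp K i).1.1
  have hAφ : MemH10 D (assemble cell node φ q) := by
    have : assemble cell node φ q = assemble cell node l q +
        assemble cell node (fun K i => φ K i - l K i) q := by
      rw [assemble_sub]; abel
    rw [this]
    exact hconf.add hD (memH10_assemble hD h hφl)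
  have hAr : MemH10 D (assemble cell node (fun K i => l K i - p K i) q) := by
    rw [assemble_sub]
    exact (H10 D hD).sub_mem hconf hAp
  have hnew : assemble cell node (fun K i => newBasis (l K i) (p K i) (ξ K i) J) q =
      assemble cell node (fun K i => l K i - p K i) q +
        ∑ j ∈ Finset.range (J + 1), assemble cell node (fun K i => ξ K i j) q := by
    rw [← assemble_sum (fun j K i => ξ K i j), ← assemble_add]
    congr 1
    ext K i x
    simp [newBasis]
  have hAnew : MemH10 D
      (assemble cell node (fun K i => newBasis (l K i) (p K i) (ξ K i) J) q) := by
    rw [hnew]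
    exact hAr.add hD ((H10 D hD).sum_mem fun j _ => hAξ j)
  refine ⟨hAφ, hAnew, ⟨_, hAr.1⟩, fun j => ⟨_, (hAξ j).1⟩, ?_, fun j => ?_, fun w hw => ?_,
    fun w hw => ?_, fun w hw => ?_, fun j w hw => ?_, ?_⟩
  · have hsub : ∀ K i, MemH10 (cell K) (φ K i - (l K i - p K i)) := fun K i => by
      have : φ K i - (l K i - p K i) = (φ K i - l K i) + p K i := by abel
      rw [this]
      exact (hφl K i).add (h.1 K) (hp K i).1
    have e : assemble cell node φ q - assemble cell node (fun K i => l K i - p K i) q =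
        assemble cell node (fun K i => φ K i - (l K i - p K i)) q := assemble_sub.symm
    rw [mem_bubbleSpace, AddSubgroupClass.coe_sub, e]
    exact ⟨memH10_assemble hD h hsub, memH10_cell_assemble h hsub⟩
  · rw [mem_bubbleSpace]
    exact ⟨hAξ j, memH10_cell_assemble h fun K i => (hξ K i).1 j⟩
  · rw [mem_bubbleSpace] at hw
    rw [formBilin_apply, formBilin_apply,
      form_assemble_left hD h hc₀ (fun K i => (hφ K i).1) hAφ.1 w.2,
      form_assemble_left hD h hc₁ (fun K i => (hφ K i).1) hAφ.1 w.2]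
    simp only [← Finset.sum_add_distrib]
    refine Finset.sum_eq_zero fun K _ => Finset.sum_eq_zero fun i _ => ?_
    split_ifs
    · rw [← form_coeff_add (h.1 K) (hc₀.mono (h.2.1 K)) (hc₁.mono (h.2.1 K))
        (fun x hx => hsplit x (h.2.1 K hx)) (hφ K i).1 (hw.2 K).1]
      exact (hφ K i).2.2 w (hw.2 K)
    · simp
  · rw [mem_bubbleSpace] at hw
    rw [formBilin_apply, form_assemble_left hD h hc₀ hr hAr.1 w.2]
    refine Finset.sum_eq_zero fun K _ => Finset.sum_eq_zero fun i _ => ?_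
    split_ifs
    · rw [sub_eq_add_neg, form_add_left (h.1 K) (hc₀.mono (h.2.1 K)) (hl K i)
        ((H1 (cell K)).neg_mem (hp K i).1.1) (hw.2 K).1, form_neg_left (h.1 K) (hp K i).1.1,
        (hp K i).2 w (hw.2 K), add_neg_cancel]
    · rfl
  · rw [mem_bubbleSpace] at hw
    rw [formBilin_apply, formBilin_apply,
      form_assemble_left hD h hc₀ (fun K i => ((hξ K i).1 0).1) (hAξ 0).1 w.2,
      form_assemble_left hD h hc₁ hr hAr.1 w.2]
    simp only [← Finset.sum_neg_distrib]
    refine Finset.sum_congr rfl fun K _ => Finset.sum_congr rfl fun i _ => ?_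
    split_ifs
    -- The first bubble equation has source Πl - l, the negative of the local r; hence the minus
    -- sign.
    · rw [(hξ K i).2.1 w (hw.2 K), ← form_neg_left (h.1 K) (hr K i), neg_sub]
      rfl
    · simp
  · rw [mem_bubbleSpace] at hw
    rw [formBilin_apply, formBilin_apply,
      form_assemble_left hD h hc₀ (fun K i => ((hξ K i).1 (j + 1)).1) (hAξ (j + 1)).1 w.2,
      form_assemble_left hD h hc₁ (fun K i => ((hξ K i).1 j).1) (hAξ j).1 w.2]
    simp only [← Finset.sum_neg_distrib]
    refine Finset.sum_congr rfl fun K _ => Finset.sum_congr rfl fun i _ => ?_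
    split_ifs
    · exact (hξ K i).2.2 j w (hw.2 K)
    · simp
  · apply Subtype.ext
    simp only [Submodule.coe_add, AddSubmonoidClass.coe_finsetSum]
    exact hnew

theorem ae_abs_le_eta_mul (hD : IsOpen D) (h : IsPartition D cell) {b M : ℝ} (hb : 0 < b)
    (hk₀ : ∀ x ∈ D, b ≤ k₀ x) (hk₁ : ∀ x ∈ D, ‖k₁ x‖ ≤ M) :
    ∀ᵐ x ∂volume.restrict D, |k₁ x| ≤ eta cell k₀ k₁ * k₀ x := by
  have hbd : ∀ x ∈ D, ‖k₁ x / k₀ x‖ ≤ M / b := fun x hx => by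
    have hpos := hb.trans_le (hk₀ x hx)
    rw [norm_div, Real.norm_of_nonneg hpos.le]
    exact div_le_div₀ ((norm_nonneg _).trans (hk₁ x hx)) (hk₁ x hx) hb (hk₀ x hx)
  filter_upwards [h.ae_norm_le_iSup hbd, ae_restrict_mem hD.measurableSet] with x hx hxD
  have hpos := hb.trans_le (hk₀ x hxD)
  rwa [norm_div, Real.norm_of_nonneg hpos.le, div_le_iff₀ hpos] at hx

/-- Since c̃²/2 is the square of the maximum of ‖√(k₀/k)‖, it serves as the constant γ of
`IsNeumannApprox.error_le`, with 2γ = c̃². -/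
theorem ae_le_cTilde_mul (hD : IsOpen D) (h : IsPartition D cell) {a b : ℝ} (ha : 0 < a)
    (hk : ∀ x ∈ D, a ≤ k x) (hk₀ : ∀ x ∈ D, 0 ≤ k₀ x) (hk₀' : ∀ x ∈ D, k₀ x ≤ b) :
    ∀ᵐ x ∂volume.restrict D, k₀ x ≤ cTilde cell k k₀ ^ 2 / 2 * k x := by
  have hbd : ∀ x ∈ D, ‖√(k₀ x / k x)‖ ≤ √(b / a) := fun x hx => by
    rw [Real.norm_of_nonneg (Real.sqrt_nonneg _)]
    exact Real.sqrt_le_sqrt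
      (div_le_div₀ ((hk₀ x hx).trans (hk₀' x hx)) (hk₀' x hx) ha (hk x hx))
  filter_upwards [h.ae_norm_le_iSup hbd, ae_restrict_mem hD.measurableSet] with x hx hxD
  have hpos := ha.trans_le (hk x hxD)
  rw [Real.norm_of_nonneg (Real.sqrt_nonneg _), Real.sqrt_le_iff, div_le_iff₀ hpos] at hx
  rw [cTilde, mul_pow, Real.sq_sqrt (by norm_num : (0 : ℝ) ≤ 2),
    mul_div_cancel_left₀ _ (by norm_num : (2 : ℝ) ≠ 0)]
  exact hx.2

end Comparison

end MsFEM

/-! ### The error estimates -/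

theorem theorem3p1 {d : ℕ} (D : Set (MsFEM.Rd d)) (hDopen : IsOpen D)
    (hDbdd : Bornology.IsBounded D)
    -- the coefficient, its splitting, and the right-hand side
    (k k₀ k₁ : MsFEM.Rd d → ℝ) (a₀ a₁ b₀ b₁ : ℝ) (ha₀ : 0 < a₀) (hb₀ : 0 < b₀)
    (hkmeas : AEStronglyMeasurable k (volume.restrict D))
    (hk₀meas : AEStronglyMeasurable k₀ (volume.restrict D))
    (hsplit : ∀ x ∈ D, k x = k₀ x + k₁ x)
    (hk : ∀ x ∈ D, a₀ ≤ k x ∧ k x ≤ a₁)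
    (hk₀ : ∀ x ∈ D, b₀ ≤ k₀ x ∧ k₀ x ≤ b₁)
    (f : MsFEM.Rd d → ℝ) (hf : MemLp f 2 (volume.restrict D))
    -- the coarse mesh: cells `K`, local vertices `i` of `K`, and their global nodes
    {T ι N : Type*} [Fintype T] [Fintype ι] [DecidableEq N]
    (cell : T → Set (MsFEM.Rd d)) (hcell : MsFEM.IsPartition D cell)
    (node : T → ι → N) (interiorNodes : Set N)
    -- the boundary data, extended to the cells, matching across cells and vanishing on `∂D`
    (l : T → ι → MsFEM.Rd d → ℝ) (hl : ∀ K i, MsFEM.MemH1 (cell K) (l K i))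
    (hconf : ∀ q ∈ interiorNodes, MsFEM.MemH10 D (MsFEM.assemble cell node l q))
    -- the standard multiscale basis functions
    (φ : T → ι → MsFEM.Rd d → ℝ)
    (hφ : ∀ K i, MsFEM.IsStdBasis k (cell K) (l K i) (φ K i))
    -- the projections `Πl` and the bubble functions
    (p : T → ι → MsFEM.Rd d → ℝ)
    (hp : ∀ K i, MsFEM.IsProjection k₀ (cell K) (l K i) (p K i))
    (ξ : T → ι → ℕ → MsFEM.Rd d → ℝ)
    (hξ : ∀ K i, MsFEM.IsBubbleSeq k₀ k₁ (cell K) (l K i) (p K i) (ξ K i))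
    (hη : MsFEM.eta cell k₀ k₁ < 1)
    (J : ℕ)
    -- the exact solution, the standard MsFEM solution, and the new MsFEM solution
    (u uh uJh : MsFEM.Rd d → ℝ)
    (hu : MsFEM.IsWeakSolution k D f u)
    (huh : MsFEM.IsGalerkinSolution k D f
      (MsFEM.feSpace cell node interiorNodes φ) uh)
    (huJh : MsFEM.IsGalerkinSolution k D f
      (MsFEM.feSpace cell node interiorNodes
        (fun K i => MsFEM.newBasis (l K i) (p K i) (ξ K i) J)) uJh) :
    MsFEM.energyNorm k D (fun x => uh x - uJh x) ≤
        Real.sqrt (MsFEM.cTilde cell k k₀) *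
          Real.sqrt (MsFEM.eta cell k₀ k₁ ^ (J + 1) +
            MsFEM.eta cell k₀ k₁ ^ (J + 1) / (1 - MsFEM.eta cell k₀ k₁ ^ (J + 1))) *
          MsFEM.energyNorm k D u ∧
      MsFEM.energyNorm k D (fun x => u x - uJh x) ≤
        Real.sqrt 2 * MsFEM.cTilde cell k k₀ *
            (MsFEM.eta cell k₀ k₁ ^ (J + 1) +
              MsFEM.eta cell k₀ k₁ ^ (J + 1) / (1 - MsFEM.eta cell k₀ k₁ ^ (J + 1))) *
            MsFEM.energyNorm k D u +
          2 * MsFEM.energyNorm k D (fun x => u x - uh x) := by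
  have hk₁eq : ∀ x ∈ D, k₁ x = k x - k₀ x := fun x hx => by rw [hsplit x hx]; ring
  have hk₁bd : ∀ x ∈ D, ‖k₁ x‖ ≤ a₁ + b₁ := fun x hx => by
    rw [hk₁eq x hx, Real.norm_eq_abs, abs_le]
    constructor <;> linarith [hk x hx, hk₀ x hx]
  have hc₀ : MsFEM.IsBddCoeff D k₀ := ⟨hk₀meas, b₁, fun x hx => by
    rw [Real.norm_of_nonneg (hb₀.le.trans (hk₀ x hx).1)]; exact (hk₀ x hx).2⟩
  have hc : MsFEM.IsBddCoeff D k := ⟨hkmeas, a₁, fun x hx => by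
    rw [Real.norm_of_nonneg (ha₀.le.trans (hk x hx).1)]; exact (hk x hx).2⟩
  have hc₁ : MsFEM.IsBddCoeff D k₁ := ⟨(hkmeas.sub hk₀meas).congr
    (ae_restrict_of_forall_mem hDopen.measurableSet fun x hx => (hk₁eq x hx).symm), _, hk₁bd⟩
  have hform : ∀ v w : MsFEM.H1 D,
      (MsFEM.formBilin hDopen hc₀ + MsFEM.formBilin hDopen hc₁) v w = MsFEM.form k D v w :=
    fun v w => (MsFEM.form_coeff_add hDopen hc₀ hc₁ hsplit v.2 w.2).symm
  have hη0 := MsFEM.eta_nonneg cell k₀ k₁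
  have hη_ae := MsFEM.ae_abs_le_eta_mul hDopen hcell hb₀ (fun x hx => (hk₀ x hx).1) hk₁bd
  have hγ_ae := MsFEM.ae_le_cTilde_mul hDopen hcell ha₀ (fun x hx => (hk x hx).1)
    (fun x hx => hb₀.le.trans (hk₀ x hx).1) (fun x hx => (hk₀ x hx).2)
  -- The spans consist of plain functions while the forms live on `H1 D`, so the relation also
  -- carries membership in H¹₀(D); this later allows testing the equation for u.
  let Rel : (MsFEM.Rd d → ℝ) → (MsFEM.Rd d → ℝ) → Prop := fun v vJ =>
    ∃ (hv : MsFEM.MemH10 D v) (hvJ : MsFEM.MemH10 D vJ),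
      MsFEM.IsNeumannApprox (MsFEM.formBilin hDopen hc₀) (MsFEM.formBilin hDopen hc₁)
        (MsFEM.bubbleSpace hDopen hcell) J ⟨v, hv.1⟩ ⟨vJ, hvJ.1⟩
  have hRzero : Rel 0 0 := ⟨.zero hDopen, .zero hDopen, .zero⟩
  have hRadd : ∀ x x' y y', Rel x y → Rel x' y' → Rel (x + x') (y + y') :=
    fun _ _ _ _ ⟨h1, h2, h3⟩ ⟨h1', h2', h3'⟩ => ⟨h1.add hDopen h1', h2.add hDopen h2', h3.add h3'⟩
  have hRsmul : ∀ (t : ℝ) x y, Rel x y → Rel (t • x) (t • y) :=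
    fun t _ _ ⟨h1, h2, h3⟩ => ⟨h1.smul hDopen t, h2.smul hDopen t, h3.smul t⟩
  have hRgen := fun q (hq : q ∈ interiorNodes) => MsFEM.isNeumannApprox_assemble hDopen hcell hc₀
    hc₁ hsplit hl (hconf q hq) hφ hp hξ J
  have hV := MsFEM.exists_mem_span_image_rel hRzero hRadd hRsmul hRgen
  have hVJ := MsFEM.exists_mem_span_image_rel (R := fun y x => Rel x y) hRzero
    (fun _ _ _ _ h h' => hRadd _ _ _ _ h h') (fun t _ _ h => hRsmul t _ _ h) hRgen
  obtain ⟨_, _, huh0, _⟩ := hV uh huh.1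
  obtain ⟨_, _, _, huJh0, _⟩ := hVJ uJh huJh.1
  have key := MsFEM.galerkin_comparison (MsFEM.formBilin hDopen hc₀) (MsFEM.formBilin hDopen hc₁)
    (MsFEM.bubbleSpace hDopen hcell) J (fun v w => MsFEM.form_comm _ _ _ _)
    (fun v w => MsFEM.form_comm _ _ _ _) hη0 hη
    (fun v => MsFEM.form_self_nonneg hDopen fun x hx => hb₀.le.trans (hk₀ x hx).1)
    (fun v => ?_) (MsFEM.cTilde_nonneg cell k k₀) (fun v => ?_)
    ((MsFEM.feSpace cell node interiorNodes φ).comap (MsFEM.H1 D).subtype)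
    ((MsFEM.feSpace cell node interiorNodes
      (fun K i => MsFEM.newBasis (l K i) (p K i) (ξ K i) J)).comap (MsFEM.H1 D).subtype)
    (fun v hv => ?_) (fun v hv => ?_) ⟨u, hu.1.1⟩ ⟨uh, huh0.1⟩ ⟨uJh, huJh0.1⟩ huh.1 huJh.1
    (fun w hw => ?_) (fun w hw => ?_)
  · simp only [hform] at key
    exact key
  -- The bound on |C(v, v)| is two one-sided comparisons of coefficients, for k₁ and for -k₁.
  · refine abs_le.2 ⟨?_, MsFEM.form_self_mono hDopen hc₁ hc₀ _
      (hη_ae.mono fun x hx => (le_abs_self _).trans hx) v.2⟩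
    have hneg : MsFEM.IsBddCoeff D (fun x => -k₁ x) :=
      ⟨hc₁.1.neg, _, fun x hx => (norm_neg (k₁ x)).trans_le (hk₁bd x hx)⟩
    have h := MsFEM.form_self_mono hDopen hneg hc₀ _
      (hη_ae.mono fun x hx => (neg_le_abs _).trans hx) v.2
    have e : MsFEM.form (fun x => -k₁ x) D v v = -MsFEM.form k₁ D v v := by
      simp only [MsFEM.form, neg_mul, integral_neg]
    rw [e] at h
    simp only [MsFEM.formBilin_apply]
    linarith
  · rw [hform]
    exact MsFEM.form_self_mono hDopen hc₀ hc _ hγ_ae v.2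
  · obtain ⟨vJ, hvJ, _, h2, h3⟩ := hV v hv
    exact ⟨⟨vJ, h2.1⟩, hvJ, h3⟩
  · obtain ⟨v', hv', h1, _, h3⟩ := hVJ v hv
    exact ⟨⟨v', h1.1⟩, hv', h3⟩
  -- The discrete space lies in H¹₀(D), so f can be eliminated in favour of u.
  · obtain ⟨_, _, hw0, _⟩ := hV w hw
    rw [hform, hform, hu.2 w hw0]
    exact huh.2 w hw
  · obtain ⟨_, _, _, hw0, _⟩ := hVJ w hw
    rw [hform, hform, hu.2 w hw0]
    exact huJh.2 w hw
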